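/- Let $k$ be an algebraically closed field of characteristic $0$, and let $n \ge 1$, $d \ge 2$ and $s \ge 1$ be integers. For $N \ge 1$, let $\mathrm{End}^N_d$ be the space of degree-$d$ endomorphisms of $\mathbb{P}^N$ over $k$, i.e. the set of classes, up to a nonzero scalar, of $(N+1)$-tuples $(f_0 : \dots : f_N)$ of degree-$d$ forms in $N+1$ variables without a common zero in $\mathbb{P}^N$. A point $P \in \mathbb{P}^N$ is a critical point of $f \in \mathrm{End}^N_d$ if the Jacobian determinant $J_f = \det(\partial f_i/\partial x_j)$ vanishes at $P$. For $t \ge 1$ put $$Y_t = Y_t(N) = \{ f \in \mathrm{End}^N_d : f \text{ has a critical point } P \text{ of period dividing } t, \text{ i.e. with } f^t(P) = P \}.$$ Let $\eta : (\mathbb{P}^1)^n \to \mathbb{P}^n$ be the Vieta map sending $(P_1, \dots, P_n)$, $P_i = (a_i : b_i)$, to the class of the binary form $\prod_{i=1}^n (b_i x - a_i y)$, where the class of a nonzero binary form of degree $n$ is identified with a point of $\mathbb{P}^n$ through its coefficients. Let $s_n : \mathrm{End}^1_d \to \mathrm{End}^n_d$ be the morphism sending $f$ to its $n$-th symmetric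 power, i.e. to the endomorphism $F$ of $\mathbb{P}^n$ with $$F(\eta(P_1, \dots, P_n)) = \eta(f(P_1), \dots, f(P_n)) \quad \text{for all } P_1, \dots, P_n \in \mathbb{P}^1.$$ Then $$s_n^{-1}(Y_s) = \bigcup_{\substack{t \,\mid\, ms \\ 1 \le m \le n}} Y_t ,$$ where $Y_s = Y_s(n) \subseteq \mathrm{End}^n_d$ on the left, and $Y_t = Y_t(1) \subseteq \mathrm{End}^1_d$ on the right; the union is over all positive integers $t$ for which there is an integer $m$ with $1 \le m \le n$ and $t \mid ms$. -/

import Mathlib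

namespace ProjDyn

/-- The projective space `ℙⁿ` over `k`. -/
abbrev PSpace (k : Type*) [Field k] (n : ℕ) : Type _ :=
  Projectivization k (Fin (n + 1) → k)

/-- Degree-`d` homogeneous forms in `n + 1` variables (together with `0`). -/
abbrev Form (k : Type*) [Field k] (n d : ℕ) : Type _ :=
  MvPolynomial.homogeneousSubmodule (Fin (n + 1)) k d

/-- `(n + 1)`-tuples of degree-`d` forms in `n + 1` variables. -/
abbrev Tuple (k : Type*) [Field k] (n d : ℕ) : Type _ :=
  Fin (n + 1) → Form k n d

section Basic

variable {k : Type*} [Field k] {n d : ℕ}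

/-- The self-map of affine space `k ^ (n + 1)` given by a tuple of forms. -/
noncomputable def Tuple.ev (f : Tuple k n d) (x : Fin (n + 1) → k) : Fin (n + 1) → k :=
  fun i => MvPolynomial.eval x (f i).1

/-- The forms of the tuple have no common zero in `ℙⁿ(k)`; for `k` algebraically closed and
`d ≥ 1` this says that the rational map `(f₀ : ⋯ : fₙ)` is a morphism of degree `d`. -/
def Tuple.Nondegenerate (f : Tuple k n d) : Prop :=
  ∀ x : Fin (n + 1) → k, f.ev x = 0 → x = 0

/-- The Jacobian determinant `det (∂ fᵢ / ∂ xⱼ)`. -/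
noncomputable def Tuple.jacobian (f : Tuple k n d) : MvPolynomial (Fin (n + 1)) k :=
  (Matrix.of fun i j : Fin (n + 1) => MvPolynomial.pderiv j (f i).1).det

theorem Tuple.ev_smul (a : k) (f : Tuple k n d) (x : Fin (n + 1) → k) :
    (a • f).ev x = a • f.ev x := by
  funext i
  simp [Tuple.ev]

theorem Tuple.ev_smul_arg (f : Tuple k n d) (a : k) (x : Fin (n + 1) → k) :
    f.ev (a • x) = a ^ d • f.ev x := by
  funext i
  have h := (MvPolynomial.mem_homogeneousSubmodule d (f i).1).1 (f i).2
  simp only [Tuple.ev, Pi.smul_apply, smul_eq_mul, MvPolynomial.eval_eq', Finset.mul_sum]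
  refine Finset.sum_congr rfl fun m hm => ?_
  have hdeg : ∑ j, m j = d := by
    have := h (MvPolynomial.mem_support_iff.1 hm)
    rw [← this, Finsupp.weight_apply, Finsupp.sum_fintype]
    · simp
    · simp
  simp only [mul_pow, Finset.prod_mul_distrib, Finset.prod_pow_eq_pow_sum, hdeg]
  ring

theorem Tuple.Nondegenerate.ne_zero {f : Tuple k n d} (hf : f.Nondegenerate) : f ≠ 0 := by
  rintro rfl
  have h := hf 1 (by funext i; simp [Tuple.ev])
  exact one_ne_zero h

theorem Tuple.Nondegenerate.smul {f : Tuple k n d} (hf : f.Nondegenerate) {a : k} (ha : a ≠ 0) :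
    (a • f).Nondegenerate := by
  intro x hx
  rw [Tuple.ev_smul] at hx
  exact hf x ((smul_eq_zero.1 hx).resolve_left ha)

theorem Tuple.Nondegenerate.ev_ne_zero {f : Tuple k n d} (hf : f.Nondegenerate)
    {x : Fin (n + 1) → k} (hx : x ≠ 0) : f.ev x ≠ 0 :=
  fun h => hx (hf x h)

end Basic

/-- The space `End^n_d` of degree-`d` endomorphisms of `ℙⁿ`: those points `(f₀ : ⋯ : fₙ)` of the
projective space of `(n + 1)`-tuples of degree-`d` forms for which the forms have no common zero
in `ℙⁿ`. (The condition does not depend on the representative.) -/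
def EndP (k : Type*) [Field k] (n d : ℕ) : Type _ :=
  {f : Projectivization k (Tuple k n d) // f.rep.Nondegenerate}

namespace EndP

variable {k : Type*} [Field k] {n d : ℕ}

theorem mk_nondegenerate (f : Tuple k n d) (hf : f.Nondegenerate) :
    (Projectivization.mk k f hf.ne_zero).rep.Nondegenerate := by
  obtain ⟨a, ha⟩ := Projectivization.exists_smul_eq_mk_rep k f hf.ne_zero
  rw [← ha]
  exact hf.smul a.ne_zero

/-- The endomorphism with a given nondegenerate lift. -/
noncomputable def mk (f : Tuple k n d) (hf : f.Nondegenerate) : EndP k n d :=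
  ⟨Projectivization.mk k f hf.ne_zero, mk_nondegenerate f hf⟩

/-- A lift of the endomorphism `f`, i.e. a tuple of forms representing it. -/
noncomputable def lift (f : EndP k n d) : Tuple k n d := f.1.rep

theorem lift_nondegenerate (f : EndP k n d) : f.lift.Nondegenerate := f.2

/-- The action of an endomorphism on the points of `ℙⁿ`. -/
noncomputable def map (f : EndP k n d) (P : PSpace k n) : PSpace k n :=
  Projectivization.mk k (f.lift.ev P.rep) (f.lift_nondegenerate.ev_ne_zero P.rep_nonzero)

/-- `P` is a critical point of `f`: it lies on the critical locus `C_f = V(J_f)`, the zero locus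
of the Jacobian determinant. -/
def IsCritical (f : EndP k n d) (P : PSpace k n) : Prop :=
  MvPolynomial.eval P.rep f.lift.jacobian = 0

theorem map_mk (f : Tuple k n d) (hf : f.Nondegenerate) (x : Fin (n + 1) → k) (hx : x ≠ 0) :
    (mk f hf).map (Projectivization.mk k x hx) =
      Projectivization.mk k (f.ev x) (hf.ev_ne_zero hx) := by
  obtain ⟨a, ha⟩ := Projectivization.exists_smul_eq_mk_rep k f hf.ne_zero
  obtain ⟨b, hb⟩ := Projectivization.exists_smul_eq_mk_rep k x hx
  refine (Projectivization.mk_eq_mk_iff' k _ _ _ _).2 ⟨(a : k) * (b : k) ^ d, ?_⟩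
  change _ = (Projectivization.mk k f hf.ne_zero).rep.ev _
  rw [← ha, ← hb]
  change _ = ((a : k) • f).ev ((b : k) • x)
  rw [Tuple.ev_smul, Tuple.ev_smul_arg, smul_smul]

end EndP

/-- The set `Y_s ⊆ End^n_d` of endomorphisms having a critical point of period dividing `s`,
i.e. a critical point fixed by the `s`-th iterate. -/
def Y (k : Type*) [Field k] (n d s : ℕ) : Set (EndP k n d) :=
  {f | ∃ P : PSpace k n, f.IsCritical P ∧ Function.IsPeriodicPt f.map s P}

/-! ### Symmetric powers -/

section Sym

open Polynomial

variable {k : Type*} [Field k]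

/-- The dehomogenization `∏ᵢ (bᵢ z - aᵢ)` of `∏ᵢ (bᵢ x - aᵢ y)`, where `vᵢ = (aᵢ, bᵢ)`. -/
noncomputable def vietaPoly {n : ℕ} (v : Fin n → Fin 2 → k) : k[X] :=
  ∏ i, (C (v i 1) * X - C (v i 0))

theorem linear_ne_zero {v : Fin 2 → k} (hv : v ≠ 0) : (C (v 1) * X - C (v 0) : k[X]) ≠ 0 := by
  intro h
  apply hv
  have h0 := congrArg (fun p => coeff p 0) h
  have h1 := congrArg (fun p => coeff p 1) h
  simp [coeff_C] at h0 h1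
  funext i
  fin_cases i
  · simpa using h0
  · simpa using h1

theorem vietaPoly_ne_zero {n : ℕ} {v : Fin n → Fin 2 → k} (hv : ∀ i, v i ≠ 0) :
    vietaPoly v ≠ 0 :=
  Finset.prod_ne_zero_iff.2 fun i _ => linear_ne_zero (hv i)

theorem linear_natDegree_le {R : Type*} [CommRing R] (a b : R) :
    (C b * X - C a : R[X]).natDegree ≤ 1 :=
  (natDegree_sub_le _ _).trans (by simpa using (natDegree_C_mul_le b X).trans natDegree_X_le)

theorem vietaPoly_natDegree_le {n : ℕ} (v : Fin n → Fin 2 → k) : (vietaPoly v).natDegree ≤ n :=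
  (natDegree_prod_le _ _).trans
    ((Finset.sum_le_sum fun i _ => linear_natDegree_le (v i 0) (v i 1)).trans (by simp))

theorem coeffs_ne_zero {n : ℕ} {p : k[X]} (hp : p ≠ 0) (hn : p.natDegree ≤ n) :
    (fun j : Fin (n + 1) => p.coeff j) ≠ 0 := by
  intro h
  apply hp
  ext j
  by_cases hj : j < n + 1
  · exact congrFun h ⟨j, hj⟩
  · rw [coeff_zero]
    exact coeff_eq_zero_of_natDegree_lt (by omega)

/-- The Vieta map `(ℙ¹)ⁿ → ℙⁿ`. It sends the points `Pᵢ = (aᵢ : bᵢ)` to the class of the form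
`∏ᵢ (bᵢ x - aᵢ y)`, the `j`-th homogeneous coordinate of the class of a binary form of degree `n`
being its coefficient at `x ^ j * y ^ (n - j)`. -/
noncomputable def vieta {n : ℕ} (P : Fin n → PSpace k 1) : PSpace k n :=
  Projectivization.mk k (fun j : Fin (n + 1) => (vietaPoly fun i => (P i).rep).coeff j)
    (coeffs_ne_zero (vietaPoly_ne_zero fun i => (P i).rep_nonzero) (vietaPoly_natDegree_le _))

/-- The dehomogenization `g(z, 1)` of a binary form `g(x, y)`. -/
noncomputable def dehom {d : ℕ} (g : Form k 1 d) : k[X] :=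
  MvPolynomial.aeval ![X, 1] g.1

/-- The polynomial `f₁(z, 1) T - f₀(z, 1)` in `z`, with coefficients in `k[T]`. -/
noncomputable def pencil {d : ℕ} (f : Tuple k 1 d) : k[X][X] :=
  C X * (dehom (f 1)).map C - (dehom (f 0)).map C

/-- The resultant with respect to `z` (in formal degrees `n` and `d`) of the generic polynomial
`∑ⱼ cⱼ zʲ` of degree `n` and of `f₁(z, 1) T - f₀(z, 1)`: a polynomial in `T` whose coefficients
are polynomials in `c₀, …, cₙ`. If `∑ⱼ cⱼ xʲ yⁿ⁻ʲ = ∏ᵢ (bᵢ x - aᵢ y)`, its value is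
`∏ᵢ (f₁(aᵢ, bᵢ) T - f₀(aᵢ, bᵢ))`. -/
noncomputable def symResultant (n : ℕ) {d : ℕ} (f : Tuple k 1 d) :
    (MvPolynomial (Fin (n + 1)) k)[X] :=
  resultant (∑ j : Fin (n + 1), monomial (j : ℕ) (C (MvPolynomial.X j)))
    ((pencil f).map (mapRingHom MvPolynomial.C)) n d

theorem coeff_prod_isHomogeneous {σ ι : Type*} (t : Finset ι) (p : ι → (MvPolynomial σ k)[X])
    (e : ι → ℕ) (h : ∀ i ∈ t, ∀ j, ((p i).coeff j).IsHomogeneous (e i)) (j : ℕ) :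
    ((∏ i ∈ t, p i).coeff j).IsHomogeneous (∑ i ∈ t, e i) := by
  classical
  induction t using Finset.induction_on generalizing j with
  | empty =>
    simp only [Finset.prod_empty, Finset.sum_empty, coeff_one]
    split_ifs
    · exact MvPolynomial.isHomogeneous_one _ _
    · exact MvPolynomial.isHomogeneous_zero _ _ _
  | insert a t ha ih =>
    rw [Finset.prod_insert ha, Finset.sum_insert ha, coeff_mul]
    exact MvPolynomial.IsHomogeneous.sum _ _ _ fun q _ =>
      (h a (Finset.mem_insert_self a t) q.1).mul
        (ih (fun i hi => h i (Finset.mem_insert_of_mem hi)) q.2)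

theorem symResultant_coeff_isHomogeneous (n : ℕ) {d : ℕ} (f : Tuple k 1 d) (j : ℕ) :
    ((symResultant n f).coeff j).IsHomogeneous d := by
  rw [symResultant, resultant, Matrix.det_apply, finsetSum_coeff]
  refine MvPolynomial.IsHomogeneous.sum _ _ _ fun σ _ => ?_
  rw [coeff_smul]
  suffices h : ((∏ i, sylvester
      (∑ j : Fin (n + 1), monomial (j : ℕ) (C (MvPolynomial.X (R := k) j)))
      ((pencil f).map (mapRingHom MvPolynomial.C)) n d (σ i) i).coeff j).IsHomogeneous d by
    rcases Int.units_eq_one_or (Equiv.Perm.sign σ) with hs | hs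
    · rw [hs, one_smul]; exact h
    · rw [hs, Units.neg_smul, one_smul]; exact h.neg
  have key := coeff_prod_isHomogeneous (k := k) (σ := Fin (n + 1)) (Finset.univ : Finset (Fin (n + d)))
    (fun i => sylvester (∑ j : Fin (n + 1), monomial (j : ℕ) (C (MvPolynomial.X (R := k) j)))
      ((pencil f).map (mapRingHom MvPolynomial.C)) n d (σ i) i)
    (fun i => Fin.addCases (fun _ => 0) (fun _ => 1) i) ?_ j
  · have hd : ∑ i : Fin (n + d), (Fin.addCases (fun _ => 0) (fun _ => 1) i : ℕ) = d := by
      simp [Fin.sum_univ_add]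
    rwa [hd] at key
  · intro i _ l
    induction i using Fin.addCases with
    | left i =>
      simp only [sylvester, Matrix.of_apply, Fin.addCases_left]
      split_ifs
      · rw [coeff_map, coe_mapRingHom, coeff_map]
        exact MvPolynomial.isHomogeneous_C _ _
      · exact MvPolynomial.isHomogeneous_zero _ _ _
    | right i =>
      simp only [sylvester, Matrix.of_apply, Fin.addCases_right]
      split_ifs
      · rw [finsetSum_coeff, finsetSum_coeff]
        refine MvPolynomial.IsHomogeneous.sum _ _ _ fun q _ => ?_
        rw [coeff_monomial]
        split_ifs
        · rw [coeff_C]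
          split_ifs
          · exact MvPolynomial.isHomogeneous_X _ _
          · exact MvPolynomial.isHomogeneous_zero _ _ _
        · exact MvPolynomial.isHomogeneous_zero _ _ _
      · exact MvPolynomial.isHomogeneous_zero _ _ _

/-- The lift of the `n`-th symmetric power: its `j`-th component is the coefficient of `T ^ j` in
the resultant above. -/
noncomputable def symTuple (n : ℕ) {d : ℕ} (f : Tuple k 1 d) : Tuple k n d :=
  fun j => ⟨(symResultant n f).coeff j,
    (MvPolynomial.mem_homogeneousSubmodule _ _).2 (symResultant_coeff_isHomogeneous n f j)⟩

theorem dehom_natDegree_le {d : ℕ} (g : Form k 1 d) : (dehom g).natDegree ≤ d := by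
  have h := (MvPolynomial.mem_homogeneousSubmodule d g.1).1 g.2
  rw [dehom, MvPolynomial.aeval_def, MvPolynomial.eval₂_eq']
  refine natDegree_sum_le_of_forall_le _ _ fun m hm => ?_
  have hdeg : m 0 + m 1 = d := by
    have := h (MvPolynomial.mem_support_iff.1 hm)
    rw [← this, Finsupp.weight_apply, Finsupp.sum_fintype]
    · simp
    · simp
  simp only [Fin.prod_univ_two, Matrix.cons_val_zero, Matrix.cons_val_one, one_pow, mul_one]
  refine (natDegree_C_mul_le _ _).trans ?_
  rw [natDegree_X_pow]
  omega

/-- The value of a binary form at `(a, b)` in terms of its dehomogenization. -/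
theorem eval_eq_dehom {d : ℕ} (g : Form k 1 d) (v : Fin 2 → k) :
    MvPolynomial.eval v g.1 =
      ∑ j ∈ Finset.range (d + 1), (dehom g).coeff j * v 0 ^ j * v 1 ^ (d - j) := by
  have h := (MvPolynomial.mem_homogeneousSubmodule d g.1).1 g.2
  rw [MvPolynomial.eval_eq', dehom, MvPolynomial.aeval_def, MvPolynomial.eval₂_eq']
  simp only [finsetSum_coeff, Finset.sum_mul]
  rw [Finset.sum_comm]
  refine Finset.sum_congr rfl fun m hm => ?_
  have hdeg : m 0 + m 1 = d := by
    have := h (MvPolynomial.mem_support_iff.1 hm)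
    rw [← this, Finsupp.weight_apply, Finsupp.sum_fintype]
    · simp
    · simp
  simp only [Fin.prod_univ_two, Matrix.cons_val_zero, Matrix.cons_val_one, one_pow, mul_one]
  rw [Finset.sum_eq_single (m 0)]
  · have : d - m 0 = m 1 := by omega
    simp [this, mul_assoc, algebraMap_eq]
  · intro j _ hj
    simp [algebraMap_eq, coeff_X_pow, hj]
  · intro hj
    exact absurd (Finset.mem_range.2 (by omega)) hj

theorem pencil_natDegree_le {d : ℕ} (f : Tuple k 1 d) : (pencil f).natDegree ≤ d :=
  (natDegree_sub_le _ _).trans (max_le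
    ((natDegree_C_mul_le _ _).trans (natDegree_map_le.trans (dehom_natDegree_le _)))
    (natDegree_map_le.trans (dehom_natDegree_le _)))

theorem resultant_mul_left_of_le {R : Type*} [CommRing R] (p q g : R[X]) {a b d : ℕ}
    (hp : p.natDegree ≤ a) (hq : q.natDegree ≤ b) (hg : g.natDegree ≤ d) :
    resultant (p * q) g (a + b) d = resultant p g a d * resultant q g b d := by
  obtain ⟨r, rfl⟩ := Nat.exists_eq_add_of_le hp
  obtain ⟨s, rfl⟩ := Nat.exists_eq_add_of_le hq
  rw [show p.natDegree + r + (q.natDegree + s) = p.natDegree + q.natDegree + (r + s) by ring,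
    resultant_add_left_deg _ _ _ _ _ natDegree_mul_le, resultant_add_left_deg _ _ _ _ _ le_rfl,
    resultant_add_left_deg _ _ _ _ _ le_rfl, resultant_mul_left _ _ _ _ hg]
  ring

theorem resultant_linear {R : Type*} [Field R] (a b : R) (g : R[X][X]) (d : ℕ)
    (hg : g.natDegree ≤ d) :
    resultant ((C b * X - C a : R[X]).map C) g 1 d =
      ∑ j ∈ Finset.range (d + 1), g.coeff j * C a ^ j * C b ^ (d - j) := by
  by_cases hb : b = 0
  · subst hb
    rw [Finset.sum_eq_single d]
    · have : ((C (0 : R) * X - C a : R[X]).map C : R[X][X]) = C (-(C a)) := by simp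
      rw [this, resultant_C_left]
      simp only [one_mul, pow_one, Nat.sub_self, pow_zero, mul_one]
      rw [neg_pow (C a) d]
      have hs : (-1 : R[X]) ^ d * (-1) ^ d = 1 := by
        rw [← mul_pow]
        simp
      linear_combination (g.coeff d * C a ^ d) * hs
    · intro j hj hjd
      have : d - j ≠ 0 := by
        have := Finset.mem_range.1 hj
        omega
      simp [this]
    · simp
  · have : ((C b * X - C a : R[X]).map C : R[X][X]) = C (C b) * (X - C (C (a / b))) := by
      simp [mul_sub, ← C_mul, mul_div_cancel₀ a hb]
    rw [this, resultant_C_mul_left, resultant_X_sub_C_left _ _ _ hg,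
      eval_eq_sum_range' (Nat.lt_succ_of_le hg), Finset.mul_sum]
    refine Finset.sum_congr rfl fun j hj => ?_
    have hj' : j ≤ d := by
      have := Finset.mem_range.1 hj
      omega
    have e : (C b : R[X]) ^ d * C (a / b) ^ j = C a ^ j * C b ^ (d - j) := by
      rw [← C_pow, ← C_pow, ← C_pow, ← C_pow, ← C_mul, ← C_mul]
      congr 1
      rw [div_pow, ← Nat.sub_add_cancel hj', pow_add, Nat.sub_add_cancel hj']
      field_simp
    linear_combination g.coeff j * e

theorem resultant_linear_pencil {d : ℕ} (f : Tuple k 1 d) (v : Fin 2 → k) :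
    resultant ((C (v 1) * X - C (v 0) : k[X]).map C) (pencil f) 1 d =
      C (f.ev v 1) * X - C (f.ev v 0) := by
  rw [resultant_linear _ _ _ _ (pencil_natDegree_le f)]
  have e : ∀ i, f.ev v i = ∑ j ∈ Finset.range (d + 1),
      (dehom (f i)).coeff j * v 0 ^ j * v 1 ^ (d - j) := fun i => eval_eq_dehom (f i) v
  rw [e 1, e 0, map_sum, map_sum, Finset.sum_mul, ← Finset.sum_sub_distrib]
  refine Finset.sum_congr rfl fun j _ => ?_
  simp only [pencil, coeff_sub, coeff_C_mul, coeff_map, C_mul, C_pow]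
  ring

theorem resultant_vietaPoly {n d : ℕ} (f : Tuple k 1 d) (v : Fin n → Fin 2 → k) :
    resultant ((vietaPoly v).map C) (pencil f) n d = vietaPoly fun i => f.ev (v i) := by
  induction n with
  | zero => simp [vietaPoly]
  | succ n ih =>
    have h1 : ∀ w : Fin (n + 1) → Fin 2 → k,
        vietaPoly w = vietaPoly (fun i => w i.castSucc) *
          (C (w (Fin.last n) 1) * X - C (w (Fin.last n) 0)) := fun w => by
      rw [vietaPoly, Fin.prod_univ_castSucc, vietaPoly]
    rw [h1 v, Polynomial.map_mul, resultant_mul_left_of_le _ _ _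
      (natDegree_map_le.trans (vietaPoly_natDegree_le _))
      (natDegree_map_le.trans (linear_natDegree_le _ _)) (pencil_natDegree_le f),
      ih, resultant_linear_pencil, h1]

theorem symTuple_ev {n d : ℕ} (f : Tuple k 1 d) (p : k[X]) (hp : p.natDegree ≤ n)
    (j : Fin (n + 1)) :
    (symTuple n f).ev (fun i => p.coeff i) j =
      (resultant (p.map C) (pencil f) n d).coeff j := by
  set ψ : MvPolynomial (Fin (n + 1)) k →+* k := MvPolynomial.eval fun i => p.coeff i with hψ
  have h : (symResultant n f).map ψ = resultant (p.map C) (pencil f) n d := by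
    rw [← coe_mapRingHom, symResultant, ← resultant_map_map]
    congr 1
    · rw [Polynomial.map_sum]
      conv_rhs => rw [p.as_sum_range' (n + 1) (Nat.lt_succ_of_le hp), Polynomial.map_sum,
        ← Fin.sum_univ_eq_sum_range (fun i => (monomial i (p.coeff i)).map C)]
      refine Finset.sum_congr rfl fun i _ => ?_
      simp [hψ]
    · rw [Polynomial.map_map, mapRingHom_comp]
      have : ψ.comp MvPolynomial.C = RingHom.id k := by
        ext; simp [hψ]
      rw [this, mapRingHom_id, Polynomial.map_id]
  rw [← h, coeff_map]
  rfl

/-- The affine form of the functional equation of symmetric powers. -/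
theorem symTuple_ev_vietaPoly {n d : ℕ} (f : Tuple k 1 d) (v : Fin n → Fin 2 → k) :
    (symTuple n f).ev (fun j => (vietaPoly v).coeff j) =
      fun j : Fin (n + 1) => (vietaPoly fun i => f.ev (v i)).coeff j := by
  funext j
  rw [symTuple_ev f _ (vietaPoly_natDegree_le v), resultant_vietaPoly]

/-- Over an algebraically closed field, every nonzero binary form is, up to a scalar, a product of
linear forms. -/
theorem exists_vietaPoly [IsAlgClosed k] (n : ℕ) (p : k[X]) (hp : p ≠ 0) (hn : p.natDegree ≤ n) :
    ∃ (u : k) (v : Fin n → Fin 2 → k), u ≠ 0 ∧ (∀ i, v i ≠ 0) ∧ p = C u * vietaPoly v := by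
  induction n generalizing p with
  | zero =>
    obtain ⟨u, rfl⟩ := natDegree_eq_zero.1 (Nat.le_zero.1 hn)
    exact ⟨u, Fin.elim0, fun h => hp (by simp [h]), fun i => i.elim0, by simp [vietaPoly]⟩
  | succ n ih =>
    by_cases h : p.natDegree ≤ n
    · obtain ⟨u, v, hu, hv, rfl⟩ := ih p hp h
      refine ⟨u, Fin.cons ![-1, 0] v, hu, fun i => ?_, ?_⟩
      · refine Fin.cases ?_ (fun i => ?_) i
        · intro h0
          simpa using congrFun h0 0
        · simpa using hv i
      · simp [vietaPoly, Fin.prod_univ_succ]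
    · obtain ⟨a, ha⟩ := IsAlgClosed.exists_root p (fun h0 => by
        rw [natDegree_eq_of_degree_eq_some h0] at h
        exact h (Nat.zero_le n))
      obtain ⟨q, rfl⟩ := dvd_iff_isRoot.2 ha
      have hq : q ≠ 0 := right_ne_zero_of_mul hp
      rw [natDegree_mul (X_sub_C_ne_zero a) hq, natDegree_X_sub_C] at hn
      obtain ⟨u, v, hu, hv, rfl⟩ := ih q hq (by omega)
      refine ⟨u, Fin.cons ![a, 1] v, hu, fun i => ?_, ?_⟩
      · refine Fin.cases ?_ (fun i => ?_) i
        · intro h0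
          simpa using congrFun h0 1
        · simpa using hv i
      · simp [vietaPoly, Fin.prod_univ_succ]
        ring

theorem symTuple_nondegenerate [IsAlgClosed k] (n : ℕ) {d : ℕ} {f : Tuple k 1 d}
    (hf : f.Nondegenerate) : (symTuple n f).Nondegenerate := by
  intro x hx
  by_contra hx0
  set p : k[X] := ∑ i : Fin (n + 1), monomial (i : ℕ) (x i) with hp
  have hcoeff : ∀ i : Fin (n + 1), p.coeff i = x i := fun i => by
    rw [hp, finsetSum_coeff, Finset.sum_eq_single i]
    · simp
    · intro j _ hj
      rw [coeff_monomial, if_neg (fun h => hj (Fin.ext h))]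
    · simp
  have hxp : x = fun i : Fin (n + 1) => p.coeff i := funext fun i => (hcoeff i).symm
  have hp0 : p ≠ 0 := fun h => hx0 (by rw [hxp, h]; funext i; simp)
  have hdeg : p.natDegree ≤ n := natDegree_sum_le_of_forall_le _ _ fun i _ =>
    (natDegree_monomial_le _).trans (Nat.le_of_lt_succ i.2)
  obtain ⟨u, v, hu, hv, hpv⟩ := exists_vietaPoly n p hp0 hdeg
  have hxv : x = u • fun i : Fin (n + 1) => (vietaPoly v).coeff i := by
    rw [hxp, hpv]
    funext i
    simp
  rw [hxv, Tuple.ev_smul_arg, symTuple_ev_vietaPoly] at hx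
  exact coeffs_ne_zero (vietaPoly_ne_zero fun i => hf.ev_ne_zero (hv i))
    (vietaPoly_natDegree_le _) ((smul_eq_zero.1 hx).resolve_left (pow_ne_zero _ hu))

/-- The symmetric power map `s_n : End^1_d → End^n_d`. The functional equation which characterizes
it is `symPower_map_vieta` below. -/
noncomputable def symPower [IsAlgClosed k] (n : ℕ) {d : ℕ} (f : EndP k 1 d) : EndP k n d :=
  EndP.mk (symTuple n f.lift) (symTuple_nondegenerate n f.lift_nondegenerate)

theorem vieta_mk {n : ℕ} (v : Fin n → Fin 2 → k) (hv : ∀ i, v i ≠ 0) :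
    vieta (fun i => Projectivization.mk k (v i) (hv i)) =
      Projectivization.mk k (fun j : Fin (n + 1) => (vietaPoly v).coeff j)
        (coeffs_ne_zero (vietaPoly_ne_zero hv) (vietaPoly_natDegree_le _)) := by
  choose a ha using fun i => Projectivization.exists_smul_eq_mk_rep k (v i) (hv i)
  refine (Projectivization.mk_eq_mk_iff' k _ _ _ _).2 ⟨∏ i, (a i : k), ?_⟩
  have h : (vietaPoly fun i => (Projectivization.mk k (v i) (hv i)).rep) =
      C (∏ i, (a i : k)) * vietaPoly v := by
    rw [vietaPoly, vietaPoly, map_prod, ← Finset.prod_mul_distrib]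
    refine Finset.prod_congr rfl fun i _ => ?_
    rw [← ha i]
    simp only [Units.smul_def, Pi.smul_apply, smul_eq_mul, C_mul]
    ring
  funext j
  rw [h, coeff_C_mul]
  rfl

/-- If `F` is the `n`-th symmetric power of `f` and `η` is the Vieta map, then
`F(η(P₁, …, Pₙ)) = η(f(P₁), …, f(Pₙ))`. -/
theorem symPower_map_vieta [IsAlgClosed k] {n d : ℕ} (f : EndP k 1 d) (P : Fin n → PSpace k 1) :
    (symPower n f).map (vieta P) = vieta fun i => f.map (P i) := by
  rw [symPower, vieta, EndP.map_mk]
  simp only [symTuple_ev_vietaPoly]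
  exact (vieta_mk (fun i => f.lift.ev (P i).rep) fun i =>
    f.lift_nondegenerate.ev_ne_zero (P i).rep_nonzero).symm

end Sym

end ProjDyn

/-! View a point of `ℙⁿ` as an effective divisor of degree `n` on `ℙ¹`, so that the symmetric power
`F` of `f` acts on divisors by push-forward. The heart of the proof is a formula for the Jacobian of
`F` (`jacobian_symTuple`): at the product of the linear forms attached to `v₁, …, vₙ` it is, up to a
power of `d`, the product of all `J_f(vᵢ)` and of all `q(vᵢ, vⱼ)` with `i < j`. Here `q(u, v) =
[f(u), f(v)] / [u, v]` is a polynomial with diagonal `J_f / d` (`bracketQuotient_diag`). Hence a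
divisor is critical for `F` iff it contains a critical point of `f` or some `q(vᵢ, vⱼ)` vanishes.

The formula comes from comparing two determinants. Replacing one linear factor at a time gives
tangent vectors at the product; together with the product itself they form a matrix of determinant
`± ∏ [vᵢ, wᵢ] ∏_{i<j} [vᵢ, vⱼ]` (`det_tangentMatrix`), and the derivative of `F` carries it to the
analogous matrix at the points `f(vᵢ)`. The common factors are cancelled along a line of tuples that
is generic at one parameter.

If `F^s` fixes a critical divisor, then `f^s` permutes its finite support, so `f` is injective
there. A zero of `q(vᵢ, vⱼ)` then forces the two points to coincide and to be critical, and each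
point of the support has period `m ≤ n` under `f^s`. Conversely, the orbit of length `m` of a
critical point, completed to degree `n` by copies of a fixed point of `f`, is a critical divisor
fixed by `F^s`. -/

namespace ProjDyn

open Polynomial

/-! ### Density arguments, derivatives along lines, and brackets -/

section Tools

variable {k : Type*} [Field k]

/-! ### Polynomial functions on the affine line -/

/-- A function `k → k` given by a polynomial. -/
def IsPolyFun (g : k → k) : Prop := ∃ p : k[X], ∀ t, p.eval t = g t

namespace IsPolyFun

theorem const (c : k) : IsPolyFun fun _ => c := ⟨C c, by simp⟩

theorem id : IsPolyFun fun t : k => t := ⟨X, by simp⟩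

theorem add {g h : k → k} (hg : IsPolyFun g) (hh : IsPolyFun h) :
    IsPolyFun fun t => g t + h t := by
  obtain ⟨p, hp⟩ := hg
  obtain ⟨q, hq⟩ := hh
  exact ⟨p + q, by simp [hp, hq]⟩

theorem mul {g h : k → k} (hg : IsPolyFun g) (hh : IsPolyFun h) :
    IsPolyFun fun t => g t * h t := by
  obtain ⟨p, hp⟩ := hg
  obtain ⟨q, hq⟩ := hh
  exact ⟨p * q, by simp [hp, hq]⟩

theorem sub {g h : k → k} (hg : IsPolyFun g) (hh : IsPolyFun h) :
    IsPolyFun fun t => g t - h t := by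
  obtain ⟨p, hp⟩ := hg
  obtain ⟨q, hq⟩ := hh
  exact ⟨p - q, by simp [hp, hq]⟩

theorem sum {ι : Type*} (s : Finset ι) {g : ι → k → k} (hg : ∀ i ∈ s, IsPolyFun (g i)) :
    IsPolyFun fun t => ∑ i ∈ s, g i t := by
  choose! p hp using hg
  exact ⟨∑ i ∈ s, p i, fun t => by
    rw [eval_finsetSum]; exact Finset.sum_congr rfl fun i hi => hp i hi t⟩

theorem prod {ι : Type*} (s : Finset ι) {g : ι → k → k} (hg : ∀ i ∈ s, IsPolyFun (g i)) :
    IsPolyFun fun t => ∏ i ∈ s, g i t := by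
  choose! p hp using hg
  exact ⟨∏ i ∈ s, p i, fun t => by
    rw [eval_prod]; exact Finset.prod_congr rfl fun i hi => hp i hi t⟩

theorem det {ι : Type*} [Fintype ι] [DecidableEq ι] {M : k → Matrix ι ι k}
    (hM : ∀ i j, IsPolyFun fun t => M t i j) : IsPolyFun fun t => (M t).det := by
  simp only [Matrix.det_apply']
  exact sum _ fun σ _ => (const _).mul (prod _ fun i _ => hM _ _)

theorem mvEval {σ : Type*} {x : k → σ → k} (hx : ∀ i, IsPolyFun fun t => x t i)
    (P : MvPolynomial σ k) : IsPolyFun fun t => MvPolynomial.eval (x t) P := by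
  induction P using MvPolynomial.induction_on with
  | C a => simpa using const a
  | add p q hp hq => simpa using hp.add hq
  | mul_X p i hp => simpa using hp.mul (hx i)

/-- Two polynomial functions which agree after multiplication by a nonzero polynomial function
are equal. -/
theorem eq_of_mul_eq [Infinite k] {g h e : k → k} (hg : IsPolyFun g) (hh : IsPolyFun h)
    (he : IsPolyFun e) {a : k} (ha : e a ≠ 0) (H : ∀ t, g t * e t = h t * e t) (t : k) :
    g t = h t := by
  obtain ⟨p, hp⟩ := hg
  obtain ⟨q, hq⟩ := hh
  obtain ⟨r, hr⟩ := he
  have h1 : p * r = q * r := Polynomial.funext fun t => by simp [hp, hq, hr, H]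
  have h2 : r ≠ 0 := by
    rintro rfl
    exact ha (by simp [← hr])
  rw [← hp, ← hq, mul_right_cancel₀ h2 h1]

end IsPolyFun

/-! ### Directional derivatives -/

/-- The restriction of a polynomial to the line `ε ↦ x + ε y`. -/
noncomputable def along {σ : Type*} (x y : σ → k) (P : MvPolynomial σ k) : k[X] :=
  MvPolynomial.aeval (fun i => C (x i) + X * C (y i)) P

theorem eval_along {σ : Type*} (x y : σ → k) (P : MvPolynomial σ k) (t : k) :
    (along x y P).eval t = MvPolynomial.eval (x + t • y) P := by
  induction P using MvPolynomial.induction_on with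
  | C a => simp [along]
  | add p q hp hq => simp only [along, map_add, eval_add] at *; rw [hp, hq]
  | mul_X p i hp => simp only [along, map_mul, eval_mul] at *; rw [hp]; simp [mul_comm t]

theorem derivative_along {σ : Type*} [Fintype σ] (x y : σ → k) (P : MvPolynomial σ k) :
    (derivative (along x y P)).eval 0 =
      ∑ i, y i * MvPolynomial.eval x (MvPolynomial.pderiv i P) := by
  classical
  induction P using MvPolynomial.induction_on with
  | C a => simp [along, algebraMap_eq]
  | add p q hp hq =>
    have : along x y (p + q) = along x y p + along x y q := map_add _ _ _
    rw [this, derivative_add, eval_add, hp, hq, ← Finset.sum_add_distrib]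
    simp [mul_add]
  | mul_X p i hp =>
    have : along x y (p * MvPolynomial.X i) = along x y p * (C (x i) + X * C (y i)) := by
      simp [along]
    rw [this, derivative_mul, eval_add, eval_mul, eval_mul, hp, eval_along]
    simp only [Derivation.leibniz, MvPolynomial.pderiv_X, smul_eq_mul, map_add, map_mul,
      MvPolynomial.eval_X, mul_add, Finset.sum_add_distrib]
    simp [Pi.single_apply, Finset.sum_mul, apply_ite]
    rw [add_comm]
    congr 1
    · ring
    · exact Finset.sum_congr rfl fun _ _ => by ring

/-! ### The bracket of two vectors in the plane -/

/-- The bracket `u₀ v₁ - u₁ v₀`. -/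
def br (u v : Fin 2 → k) : k := u 0 * v 1 - u 1 * v 0

theorem br_swap (u v : Fin 2 → k) : br u v = -br v u := by
  simp only [br]; ring

theorem IsPolyFun.br {u v : k → Fin 2 → k} (hu : ∀ i, IsPolyFun fun t => u t i)
    (hv : ∀ i, IsPolyFun fun t => v t i) : IsPolyFun fun t => br (u t) (v t) :=
  ((hu 0).mul (hv 1)).sub ((hu 1).mul (hv 0))

theorem mk_eq_mk_iff_br {u v : Fin 2 → k} (hu : u ≠ 0) (hv : v ≠ 0) :
    Projectivization.mk k u hu = Projectivization.mk k v hv ↔ br u v = 0 := by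
  rw [Projectivization.mk_eq_mk_iff']
  constructor
  · rintro ⟨a, rfl⟩
    simp only [br, Pi.smul_apply, smul_eq_mul]; ring
  · intro h
    simp only [br] at h
    by_cases h0 : v 0 = 0
    · have h1 : v 1 ≠ 0 := fun h1 => hv (by ext i; fin_cases i <;> simp [h0, h1])
      refine ⟨u 1 / v 1, ?_⟩
      have : u 0 = 0 := by
        rw [h0] at h
        simpa [h1] using h
      ext i; fin_cases i
      · simp [h0, this]
      · simp [h1]
    · refine ⟨u 0 / v 0, ?_⟩
      ext i; fin_cases i
      · simp [h0]
      · simp only [Fin.mk_one, Pi.smul_apply, smul_eq_mul]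
        field_simp
        linear_combination h

/-! ### Values of products of linear forms -/

/-- Lets a product of linear forms be evaluated at every point of the line, infinity included. -/
theorem eval_homogenize_vietaPoly {n : ℕ} (v : Fin n → Fin 2 → k) (u : Fin 2 → k) :
    MvPolynomial.eval u ((vietaPoly v).homogenize n) = ∏ i, br u (v i) := by
  have h := homogenize_finsetProd (s := (Finset.univ : Finset (Fin n)))
    (p := fun i => (C (v i 1) * X - C (v i 0) : k[X])) (n := fun _ => 1)
    (fun i _ => linear_natDegree_le _ _)
  simp only [Finset.sum_const, Finset.card_univ, Fintype.card_fin, smul_eq_mul, mul_one] at h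
  rw [vietaPoly, h, map_prod]
  refine Finset.prod_congr rfl fun i _ => ?_
  rw [homogenize_sub, homogenize_C_mul, homogenize_X one_ne_zero, homogenize_C]
  simp [br]; ring

theorem eval_homogenize {n : ℕ} (p : k[X]) (u : Fin 2 → k) :
    MvPolynomial.eval u (p.homogenize n) =
      ∑ c : Fin (n + 1), p.coeff c * (u 0 ^ (c : ℕ) * u 1 ^ (c.rev : ℕ)) := by
  have h : ∀ ij : ℕ × ℕ, MvPolynomial.eval u (MvPolynomial.monomial
      (Finsupp.single 0 ij.1 + Finsupp.single 1 ij.2) (p.coeff ij.1)) =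
        p.coeff ij.1 * (u 0 ^ ij.1 * u 1 ^ ij.2) := fun ij => by
    rw [MvPolynomial.eval_monomial, Finsupp.prod_fintype _ _ (by simp)]
    simp
  have e : ∀ ij : ℕ × ℕ, (Finsupp.single (0 : Fin 2) ij.1).update 1 ij.2 =
      Finsupp.single 0 ij.1 + Finsupp.single 1 ij.2 := fun ij => by
    ext i; fin_cases i <;> simp
  simp only [homogenize, map_sum, e, h]
  rw [Finset.Nat.sum_antidiagonal_eq_sum_range_succ
    (fun i j => p.coeff i * (u 0 ^ i * u 1 ^ j)),
    ← Fin.sum_univ_eq_sum_range (fun i => p.coeff i * (u 0 ^ i * u 1 ^ (n - i)))]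
  refine Finset.sum_congr rfl fun c _ => ?_
  rw [Fin.val_rev, Nat.add_sub_add_right]

end Tools

/-! ### Tangent vectors at a product of linear forms -/

section Tangent

variable {k : Type*} [Field k]

theorem IsPolyFun.coeff_prod {ι : Type*} (s : Finset ι) {p : ι → k → k[X]}
    (hp : ∀ i ∈ s, ∀ j, IsPolyFun fun t => (p i t).coeff j) (j : ℕ) :
    IsPolyFun fun t => (∏ i ∈ s, p i t).coeff j := by
  classical
  induction s using Finset.induction_on generalizing j with
  | empty => simpa using IsPolyFun.const _
  | insert a s ha ih =>
    simp only [Finset.prod_insert ha, coeff_mul]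
    exact IsPolyFun.sum _ fun x _ => (hp a (Finset.mem_insert_self a s) _).mul
      (ih (fun i hi => hp i (Finset.mem_insert_of_mem hi)) _)

theorem IsPolyFun.coeff_vietaPoly {n : ℕ} {v : k → Fin n → Fin 2 → k}
    (hv : ∀ i l, IsPolyFun fun t => v t i l) (j : ℕ) :
    IsPolyFun fun t => (vietaPoly (v t)).coeff j := by
  refine IsPolyFun.coeff_prod _ (fun i _ j => ?_) j
  simp only [coeff_sub, coeff_C_mul, coeff_C]
  refine ((hv i 1).mul (const _)).sub ?_
  split_ifs
  · exact hv i 0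
  · exact const 0

/-- The product is linear in each factor, so moving one factor along a line moves the product along
a line. -/
theorem vietaPoly_update_coeff {n : ℕ} (v : Fin n → Fin 2 → k) (i : Fin n) (a : Fin 2 → k)
    (j : ℕ) : (vietaPoly (Function.update v i a)).coeff j =
      a 1 * (X * ∏ l ∈ Finset.univ \ {i}, (C (v l 1) * X - C (v l 0))).coeff j -
        a 0 * (∏ l ∈ Finset.univ \ {i}, (C (v l 1) * X - C (v l 0))).coeff j := by
  have h : (fun l => (C (Function.update v i a l 1) * X - C (Function.update v i a l 0) : k[X])) =
      Function.update (fun l => (C (v l 1) * X - C (v l 0) : k[X])) i (C (a 1) * X - C (a 0)) := by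
    funext l
    by_cases hl : l = i
    · subst hl; simp
    · simp [hl]
  rw [vietaPoly, h, Finset.prod_update_of_mem (Finset.mem_univ i), sub_mul, mul_assoc, coeff_sub,
    coeff_C_mul, coeff_C_mul]

/-- The matrix whose rows are the coefficients of `∏ₗ ℓ(vₗ)` and of the products in which the
factor `ℓ(vᵢ)` is replaced by `ℓ(wᵢ)`. -/
noncomputable def tangentMatrix {n : ℕ} (v w : Fin n → Fin 2 → k) :
    Matrix (Fin (n + 1)) (Fin (n + 1)) k :=
  fun r c => (Fin.cons (α := fun _ => k[X]) (vietaPoly v)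
    (fun i => vietaPoly (Function.update v i (w i))) r).coeff c

theorem IsPolyFun.tangentMatrix {n : ℕ} {v w : k → Fin n → Fin 2 → k}
    (hv : ∀ i l, IsPolyFun fun t => v t i l) (hw : ∀ i l, IsPolyFun fun t => w t i l)
    (r c : Fin (n + 1)) : IsPolyFun fun t => tangentMatrix (v t) (w t) r c := by
  refine Fin.cases ?_ (fun i => ?_) r
  · exact coeff_vietaPoly hv _
  · refine coeff_vietaPoly (v := fun t => Function.update (v t) i (w t i)) (fun l e => ?_) _
    by_cases hl : l = i
    · subst hl; simpa using hw l e
    · simpa [hl] using hv l e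

/-- The product of the brackets of the pairs `i < j`. -/
noncomputable def disc {n : ℕ} (v : Fin n → Fin 2 → k) : k :=
  ∏ i, ∏ j ∈ Finset.Ioi i, br (v i) (v j)

theorem IsPolyFun.disc {n : ℕ} {v : k → Fin n → Fin 2 → k}
    (hv : ∀ i l, IsPolyFun fun t => v t i l) : IsPolyFun fun t => disc (v t) :=
  prod _ fun i _ => prod _ fun j _ => br (hv i) (hv j)

/-- Multiplying by a transposed Vandermonde matrix evaluates the forms of the rows at `u, v₁, …,
vₙ`. Since `∏ₗ ℓ(vₗ)` vanishes at every `vⱼ`, and still does for `j ≠ i` once its `i`-th factor is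
replaced, the result is triangular. The Vandermonde determinant stays on both sides because it may
be zero. -/
theorem tangentMatrix_mul_vandermonde {n : ℕ} (v w : Fin n → Fin 2 → k) (u : Fin 2 → k) :
    (tangentMatrix v w).det * ((∏ i, br (v i) u) * ∏ i, ∏ j ∈ Finset.Ioi i, br (v j) (v i)) =
      ((-1) ^ n * (∏ i, br (v i) (w i)) * disc v) *
        ((∏ i, br (v i) u) * ∏ i, ∏ j ∈ Finset.Ioi i, br (v j) (v i)) := by
  set z : Fin (n + 1) → Fin 2 → k := Fin.cons u v with hz
  set V := Matrix.projVandermonde (fun j => z j 0) (fun j => z j 1) with hV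
  have hVdet : V.det = (∏ i, br (v i) u) * ∏ i, ∏ j ∈ Finset.Ioi i, br (v j) (v i) := by
    rw [hV, Matrix.det_projVandermonde, Fin.prod_univ_succ, Fin.prod_Ioi_zero]
    simp only [Fin.prod_Ioi_succ, hz, Fin.cons_zero, Fin.cons_succ]
    congr 1
    · exact Finset.prod_congr rfl fun i _ => by simp only [br]; ring
    · exact Finset.prod_congr rfl fun i _ => Finset.prod_congr rfl fun j _ => by
        simp only [br]; ring
  have hent0 : ∀ j, (tangentMatrix v w * V.transpose) 0 j = ∏ l, br (z j) (v l) := fun j => by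
    rw [← eval_homogenize_vietaPoly, eval_homogenize, Matrix.mul_apply]
    rfl
  have hent : ∀ i j, (tangentMatrix v w * V.transpose) (Fin.succ i) j =
      br (z j) (w i) * ∏ l ∈ Finset.univ \ {i}, br (z j) (v l) := fun i j => by
    have h : (fun l => br (z j) (Function.update v i (w i) l)) =
        Function.update (fun l => br (z j) (v l)) i (br (z j) (w i)) := by
      funext l
      by_cases hl : l = i
      · subst hl; simp
      · simp [hl]
    rw [← Finset.prod_update_of_mem (Finset.mem_univ i), ← h, ← eval_homogenize_vietaPoly,
      eval_homogenize, Matrix.mul_apply]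
    rfl
  have hself : ∀ a : Fin 2 → k, br a a = 0 := fun a => by simp only [br]; ring
  have htri : (tangentMatrix v w * V.transpose).det =
      (∏ i, br u (v i)) * ∏ i, br (v i) (w i) * ∏ l ∈ Finset.univ \ {i}, br (v i) (v l) := by
    rw [Matrix.det_of_isLowerTriangular, Fin.prod_univ_succ]
    · simp only [hent0, hent, hz, Fin.cons_zero, Fin.cons_succ]
    · intro i j hij
      have hij : i < j := hij
      revert hij
      refine Fin.cases ?_ (fun j => ?_) j
      · intro h; exact absurd h (Fin.not_lt_zero _)
      · refine Fin.cases (fun _ => ?_) (fun i hij => ?_) i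
        · rw [hent0]
          exact Finset.prod_eq_zero (Finset.mem_univ j) (by simp [hz, hself])
        · rw [hent]
          refine mul_eq_zero_of_right _ (Finset.prod_eq_zero (i := j) ?_ (by simp [hz, hself]))
          have : i ≠ j := fun h => by subst h; exact lt_irrefl _ hij
          simp [this.symm]
  -- Each unordered pair of indices occurs in both orders: one gives `disc v`, the other the
  -- Vandermonde factor.
  have hoff : ∏ i, ∏ l ∈ Finset.univ \ {i}, br (v i) (v l) =
      disc v * ∏ i, ∏ j ∈ Finset.Ioi i, br (v j) (v i) := by
    have h := Finset.prod_prod_Ioi_mul_eq_prod_prod_off_diag (fun i j : Fin n => br (v j) (v i))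
    simp only [Finset.prod_mul_distrib] at h
    simp only [← Finset.compl_eq_univ_sdiff, disc]
    exact h.symm
  have hsign : ∏ i, br u (v i) = (-1) ^ n * ∏ i, br (v i) u := by
    simp only [br_swap u, Finset.prod_neg, Finset.card_univ, Fintype.card_fin]
  rw [← hVdet, ← Matrix.det_transpose V, ← Matrix.det_mul, htri, Finset.prod_mul_distrib, hoff,
    hsign, Matrix.det_transpose, hVdet]
  ring

/-- A line of `n`-tuples of vectors with value `v` at `0` and generic value at `1`. -/
def genericLine {n : ℕ} (v : Fin n → Fin 2 → k) (t : k) (i : Fin n) : Fin 2 → k :=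
  fun l => v i l + t * (![((i : ℕ) : k), 1] l - v i l)

theorem genericLine_zero {n : ℕ} (v : Fin n → Fin 2 → k) : genericLine v 0 = v := by
  funext i l
  simp [genericLine]

theorem genericLine_one {n : ℕ} (v : Fin n → Fin 2 → k) (i : Fin n) :
    genericLine v 1 i = ![((i : ℕ) : k), 1] := by
  funext l
  simp [genericLine]

theorem isPolyFun_genericLine {n : ℕ} (v : Fin n → Fin 2 → k) (i : Fin n) (l : Fin 2) :
    IsPolyFun fun t => genericLine v t i l :=
  (IsPolyFun.const _).add (IsPolyFun.id.mul (IsPolyFun.const _))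

/-- At parameter `1` the points are `0, 1, …, n - 1`; in characteristic zero none of them is `-1`,
which can thus serve as the auxiliary point. -/
theorem br_genericLine_one_ne_zero [CharZero k] {n : ℕ} (v : Fin n → Fin 2 → k) (i : Fin n) :
    br (genericLine v 1 i) ![-1, 1] ≠ 0 := by
  rw [genericLine_one]
  simp only [br, Matrix.cons_val_zero, Matrix.cons_val_one, mul_one, one_mul, sub_neg_eq_add]
  exact Nat.cast_add_one_ne_zero _

theorem br_genericLine_one_ne_zero' [CharZero k] {n : ℕ} (v : Fin n → Fin 2 → k) {i j : Fin n}
    (h : i ≠ j) : br (genericLine v 1 i) (genericLine v 1 j) ≠ 0 := by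
  rw [genericLine_one, genericLine_one]
  simp only [br, Matrix.cons_val_zero, Matrix.cons_val_one, mul_one, one_mul, sub_ne_zero]
  exact fun h' => h (Fin.ext (Nat.cast_injective h'))

/-- Both sides are polynomial along `genericLine v`, and the Vandermonde factor is nonzero at
parameter `1`. It therefore cancels identically, in particular at parameter `0`, where the tuple is
`v`. -/
theorem det_tangentMatrix [CharZero k] {n : ℕ} (v w : Fin n → Fin 2 → k) :
    (tangentMatrix v w).det = (-1) ^ n * (∏ i, br (v i) (w i)) * disc v := by
  have hl := isPolyFun_genericLine v
  have hbr : IsPolyFun fun t => ∏ i, br (genericLine v t i) ![-1, 1] :=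
    IsPolyFun.prod _ fun i _ => IsPolyFun.br (hl i) fun _ => IsPolyFun.const _
  have hbr' : IsPolyFun fun t => ∏ i, br (genericLine v t i) (w i) :=
    IsPolyFun.prod _ fun i _ => IsPolyFun.br (hl i) fun _ => IsPolyFun.const _
  have H := IsPolyFun.eq_of_mul_eq
    (IsPolyFun.det (M := fun t => tangentMatrix (genericLine v t) w)
      (IsPolyFun.tangentMatrix hl fun _ _ => IsPolyFun.const _))
    (((IsPolyFun.const ((-1) ^ n)).mul hbr').mul (IsPolyFun.disc hl))
    (hbr.mul (IsPolyFun.prod Finset.univ fun i _ => IsPolyFun.prod (Finset.Ioi i) fun j _ =>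
      IsPolyFun.br (hl j) (hl i))) (a := 1) ?_
    (fun t => tangentMatrix_mul_vandermonde (genericLine v t) w _) 0
  · simpa only [genericLine_zero] using H
  · refine mul_ne_zero (Finset.prod_ne_zero_iff.2 fun i _ => br_genericLine_one_ne_zero v i)
      (Finset.prod_ne_zero_iff.2 fun i _ => Finset.prod_ne_zero_iff.2 fun j hj =>
        br_genericLine_one_ne_zero' v (Finset.mem_Ioi.1 hj).ne')

/-! ### The derivative of a tuple of forms -/

/-- The derivative at `x` in the direction `y` of the map given by a tuple of forms. -/
noncomputable def Tuple.deriv {n d : ℕ} (f : Tuple k n d) (x y : Fin (n + 1) → k) :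
    Fin (n + 1) → k :=
  fun j => ∑ i, y i * MvPolynomial.eval x (MvPolynomial.pderiv i (f j).1)

/-- Euler's identity. -/
theorem Tuple.deriv_self {n d : ℕ} (f : Tuple k n d) (x : Fin (n + 1) → k) :
    f.deriv x x = (d : k) • f.ev x := by
  funext j
  have h := congrArg (MvPolynomial.eval x)
    ((MvPolynomial.mem_homogeneousSubmodule d (f j).1).1 (f j).2).sum_X_mul_pderiv
  simpa [Tuple.deriv, Tuple.ev] using h

theorem Tuple.eval_jacobian {n d : ℕ} (f : Tuple k n d) (x : Fin (n + 1) → k) :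
    MvPolynomial.eval x f.jacobian =
      (Matrix.of fun i j => MvPolynomial.eval x (MvPolynomial.pderiv j (f i).1)).det := by
  rw [Tuple.jacobian, RingHom.map_det]
  rfl

/-- Apply the functional equation to the product with `i`-th factor `ℓ(vᵢ + t w)` and differentiate
at `t = 0`; only that factor depends on `t`. -/
theorem symTuple_deriv [Infinite k] {n d : ℕ} (f : Tuple k 1 d) (v : Fin n → Fin 2 → k)
    (i : Fin n) (w : Fin 2 → k) (j : Fin (n + 1)) :
    (symTuple n f).deriv (fun c => (vietaPoly v).coeff c)
        (fun c => (vietaPoly (Function.update v i w)).coeff c) j =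
      (vietaPoly (Function.update (fun l => f.ev (v l)) i (f.deriv (v i) w))).coeff j := by
  have h : along (fun c : Fin (n + 1) => (vietaPoly v).coeff c)
      (fun c => (vietaPoly (Function.update v i w)).coeff c) (symTuple n f j).1 =
      along (v i) w (f 1).1 * C ((X * ∏ l ∈ Finset.univ \ {i},
        (C (f.ev (v l) 1) * X - C (f.ev (v l) 0))).coeff j) -
      along (v i) w (f 0).1 * C ((∏ l ∈ Finset.univ \ {i},
        (C (f.ev (v l) 1) * X - C (f.ev (v l) 0))).coeff j) := by
    refine Polynomial.funext fun t => ?_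
    have hadd : (fun c : Fin (n + 1) => (vietaPoly v).coeff c) +
        t • (fun c : Fin (n + 1) => (vietaPoly (Function.update v i w)).coeff c) =
        fun c : Fin (n + 1) => (vietaPoly (Function.update v i (v i + t • w))).coeff c := by
      funext c
      have h0 := vietaPoly_update_coeff v i (v i) c
      rw [Function.update_eq_self] at h0
      simp only [Pi.add_apply, Pi.smul_apply, smul_eq_mul, vietaPoly_update_coeff, h0]
      ring
    have hupd : (fun l => f.ev (Function.update v i (v i + t • w) l)) =
        Function.update (fun l => f.ev (v l)) i (f.ev (v i + t • w)) := by
      funext l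
      by_cases hl : l = i
      · subst hl; simp
      · simp [hl]
    have key := congrFun (symTuple_ev_vietaPoly f (Function.update v i (v i + t • w))) j
    rw [hupd, vietaPoly_update_coeff] at key
    rw [eval_along, hadd, eval_sub, eval_mul, eval_mul, eval_C, eval_C, eval_along, eval_along]
    exact key
  have h' := congrArg (fun p => (derivative p).eval 0) h
  simp only [derivative_sub, derivative_mul, derivative_C, mul_zero, add_zero, eval_sub, eval_mul,
    eval_C, derivative_along] at h'
  rw [vietaPoly_update_coeff]
  exact h'

/-- The derivative of the symmetric power sends tangent rows to tangent rows; the first row, being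
the base point, is scaled by `d` by Euler's identity. -/
theorem det_tangentMatrix_mul_jacobian [Infinite k] {n d : ℕ} (f : Tuple k 1 d)
    (v w : Fin n → Fin 2 → k) :
    (tangentMatrix v w).det *
        MvPolynomial.eval (fun c : Fin (n + 1) => (vietaPoly v).coeff c) (symTuple n f).jacobian =
      d * (tangentMatrix (fun i => f.ev (v i)) fun i => f.deriv (v i) (w i)).det := by
  set J : Matrix (Fin (n + 1)) (Fin (n + 1)) k := Matrix.of fun i j =>
    MvPolynomial.eval (fun c : Fin (n + 1) => (vietaPoly v).coeff c)
      (MvPolynomial.pderiv j (symTuple n f i).1) with hJ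
  have h : tangentMatrix v w * J.transpose =
      Matrix.diagonal (Fin.cons (d : k) fun _ => 1) *
        tangentMatrix (fun i => f.ev (v i)) fun i => f.deriv (v i) (w i) := by
    ext r j
    rw [Matrix.diagonal_mul, Matrix.mul_apply]
    refine Fin.cases ?_ (fun i => ?_) r
    · have := congrFun ((symTuple n f).deriv_self fun c => (vietaPoly v).coeff c) j
      rw [Pi.smul_apply, smul_eq_mul, symTuple_ev_vietaPoly] at this
      exact this
    · rw [Fin.cons_succ, one_mul]
      exact symTuple_deriv f v i (w i) j
  have h' := congrArg Matrix.det h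
  rw [Matrix.det_mul, Matrix.det_mul, Matrix.det_transpose, Matrix.det_diagonal,
    Fin.prod_univ_succ] at h'
  simpa [Tuple.eval_jacobian, hJ] using h'

end Tangent

/-! ### The Jacobian formula and critical divisors -/

section Criterion

variable {k : Type*} [Field k]

/-- After removing common factors, what remains is `± ((x y')^e - (y x')^e)`. -/
theorem bracket_dvd_monomial_sub {R : Type*} [CommRing R] (x y x' y' : R) {a b a' b' : ℕ}
    (h : a + b = a' + b') :
    x * y' - y * x' ∣ x ^ a * y ^ b * (x' ^ a' * y' ^ b') - x ^ a' * y ^ b' * (x' ^ a * y' ^ b) := by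
  wlog hle : a ≤ a' generalizing a b a' b'
  · rw [← dvd_neg, neg_sub]
    exact this h.symm (by omega)
  obtain ⟨e, rfl⟩ := Nat.exists_eq_add_of_le hle
  obtain rfl : b = b' + e := by omega
  have : x ^ a * y ^ (b' + e) * (x' ^ (a + e) * y' ^ b') -
      x ^ (a + e) * y ^ b' * (x' ^ a * y' ^ (b' + e)) =
      ((x * y') ^ e - (y * x') ^ e) * -((x * x') ^ a * (y * y') ^ b') := by
    ring
  rw [this]
  exact (sub_dvd_pow_sub_pow _ _ _).mul_right _

theorem form_aeval {R : Type*} [CommRing R] [Algebra k R] {d : ℕ} (g : Form k 1 d) (U : Fin 2 → R) :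
    MvPolynomial.aeval U g.1 = ∑ m ∈ g.1.support,
      algebraMap k R (g.1.coeff m) * (U 0 ^ m 0 * U 1 ^ m 1) := by
  rw [MvPolynomial.aeval_def, MvPolynomial.eval₂_eq']
  simp only [Fin.prod_univ_two]

theorem form_degree {d : ℕ} (g : Form k 1 d) {m : Fin 2 →₀ ℕ} (hm : m ∈ g.1.support) :
    m 0 + m 1 = d := by
  have := (MvPolynomial.mem_homogeneousSubmodule d g.1).1 g.2 (MvPolynomial.mem_support_iff.1 hm)
  rw [← this, Finsupp.weight_apply, Finsupp.sum_fintype]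
  · simp
  · simp

theorem bracket_dvd_form {R : Type*} [CommRing R] [Algebra k R] {d : ℕ} (g h : Form k 1 d)
    (U V : Fin 2 → R) :
    U 0 * V 1 - U 1 * V 0 ∣ MvPolynomial.aeval U g.1 * MvPolynomial.aeval V h.1 -
      MvPolynomial.aeval U h.1 * MvPolynomial.aeval V g.1 := by
  rw [form_aeval, form_aeval, form_aeval, form_aeval, Finset.sum_mul_sum, Finset.sum_mul_sum,
    Finset.sum_comm (s := h.1.support), ← Finset.sum_sub_distrib]
  refine Finset.dvd_sum fun m hm => ?_
  rw [← Finset.sum_sub_distrib]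
  refine Finset.dvd_sum fun m' hm' => ?_
  have key := bracket_dvd_monomial_sub (U 0) (U 1) (V 0) (V 1)
    ((form_degree g hm).trans (form_degree h hm').symm)
  refine (key.mul_left (algebraMap k R (g.1.coeff m) * algebraMap k R (h.1.coeff m'))).trans
    (dvd_of_eq ?_)
  ring

/-- Dividing in the polynomial ring, at generic `u` and `v`, gives a quotient that still makes sense
where `[u, v] = 0`. -/
theorem exists_bracketQuotient {d : ℕ} (f : Tuple k 1 d) :
    ∃ q : MvPolynomial (Fin 2 ⊕ Fin 2) k, ∀ u v : Fin 2 → k,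
      br (f.ev u) (f.ev v) = br u v * MvPolynomial.eval (Sum.elim u v) q := by
  obtain ⟨q, hq⟩ := bracket_dvd_form (f 0) (f 1)
    (fun i => (MvPolynomial.X (Sum.inl i) : MvPolynomial (Fin 2 ⊕ Fin 2) k))
    (fun i => MvPolynomial.X (Sum.inr i))
  refine ⟨q, fun u v => ?_⟩
  have h := congrArg (MvPolynomial.eval (Sum.elim u v)) hq
  have e1 : ∀ P : MvPolynomial (Fin 2) k, MvPolynomial.eval (Sum.elim u v)
      (MvPolynomial.aeval (fun i => (MvPolynomial.X (Sum.inl i) :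
        MvPolynomial (Fin 2 ⊕ Fin 2) k)) P) = MvPolynomial.eval u P := fun P => by
    induction P using MvPolynomial.induction_on with
    | C a => simp
    | add p q hp hq => rw [map_add, map_add, map_add, hp, hq]
    | mul_X p i hp => rw [map_mul, map_mul, map_mul, hp]; simp
  have e2 : ∀ P : MvPolynomial (Fin 2) k, MvPolynomial.eval (Sum.elim u v)
      (MvPolynomial.aeval (fun i => (MvPolynomial.X (Sum.inr i) :
        MvPolynomial (Fin 2 ⊕ Fin 2) k)) P) = MvPolynomial.eval v P := fun P => by
    induction P using MvPolynomial.induction_on with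
    | C a => simp
    | add p q hp hq => rw [map_add, map_add, map_add, hp, hq]
    | mul_X p i hp => rw [map_mul, map_mul, map_mul, hp]; simp
  simp only [map_sub, map_mul, e1, e2, MvPolynomial.eval_X, Sum.elim_inl, Sum.elim_inr] at h
  exact h

/-- The quotient of `[f(u), f(v)]` by `[u, v]`, where `[·, ·]` is the bracket. -/
noncomputable def bracketQuotient {d : ℕ} (f : Tuple k 1 d) : MvPolynomial (Fin 2 ⊕ Fin 2) k :=
  (exists_bracketQuotient f).choose

theorem br_ev {d : ℕ} (f : Tuple k 1 d) (u v : Fin 2 → k) :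
    br (f.ev u) (f.ev v) = br u v * MvPolynomial.eval (Sum.elim u v) (bracketQuotient f) :=
  (exists_bracketQuotient f).choose_spec u v

theorem Tuple.deriv_apply_two {d : ℕ} (f : Tuple k 1 d) (u w : Fin 2 → k) (j : Fin 2) :
    f.deriv u w j = w 0 * MvPolynomial.eval u (MvPolynomial.pderiv 0 (f j).1) +
      w 1 * MvPolynomial.eval u (MvPolynomial.pderiv 1 (f j).1) :=
  Fin.sum_univ_two _

/-- By Euler, `d f(u) = Df(u) u`, and a linear map of the plane scales the bracket by its
determinant. -/
theorem br_ev_deriv {d : ℕ} (f : Tuple k 1 d) (u w : Fin 2 → k) :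
    d * br (f.ev u) (f.deriv u w) = MvPolynomial.eval u f.jacobian * br u w := by
  have h0 := congrFun (f.deriv_self u) 0
  have h1 := congrFun (f.deriv_self u) 1
  rw [Tuple.deriv_apply_two, Pi.smul_apply, smul_eq_mul] at h0 h1
  rw [Tuple.eval_jacobian, Matrix.det_fin_two]
  simp only [br, Tuple.deriv_apply_two, Matrix.of_apply]
  linear_combination (-(w 0 * MvPolynomial.eval u (MvPolynomial.pderiv 0 (f 1).1) +
    w 1 * MvPolynomial.eval u (MvPolynomial.pderiv 1 (f 1).1))) * h0 +
    (w 0 * MvPolynomial.eval u (MvPolynomial.pderiv 0 (f 0).1) +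
    w 1 * MvPolynomial.eval u (MvPolynomial.pderiv 1 (f 0).1)) * h1

theorem exists_br_ne_zero {u : Fin 2 → k} (hu : u ≠ 0) : ∃ w, br u w ≠ 0 := by
  by_contra! h
  apply hu
  have h0 := h ![0, 1]
  have h1 := h ![1, 0]
  simp [br] at h0 h1
  ext i; fin_cases i <;> simp [h0, h1]

/-- Differentiate `[f(u), f(u + t w)] = t [u, w] q(u, u + t w)` at `t = 0`, with `w` chosen so that
`[u, w] ≠ 0`. -/
theorem bracketQuotient_diag [Infinite k] {d : ℕ} (f : Tuple k 1 d) {u : Fin 2 → k} (hu : u ≠ 0) :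
    d * MvPolynomial.eval (Sum.elim u u) (bracketQuotient f) =
      MvPolynomial.eval u f.jacobian := by
  obtain ⟨w, hw⟩ := exists_br_ne_zero hu
  have h : C (f.ev u 0) * along u w (f 1).1 - C (f.ev u 1) * along u w (f 0).1 =
      X * C (br u w) * along (Sum.elim u u) (Sum.elim (0 : Fin 2 → k) w) (bracketQuotient f) := by
    refine Polynomial.funext fun t => ?_
    have key := br_ev f u (u + t • w)
    have e : (Sum.elim u u + t • Sum.elim (0 : Fin 2 → k) w : Fin 2 ⊕ Fin 2 → k) =
        Sum.elim u (u + t • w) := by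
      ext i; rcases i with i | i <;> simp
    have e' : br u (u + t • w) = t * br u w := by
      simp only [br, Pi.add_apply, Pi.smul_apply, smul_eq_mul]; ring
    simp only [eval_sub, eval_mul, eval_C, eval_X, eval_along, e]
    rw [e'] at key
    exact key
  have h' := congrArg (fun p => (derivative p).eval 0) h
  simp only [derivative_sub, derivative_mul, derivative_C, derivative_X, eval_sub, eval_add,
    eval_mul, eval_C, eval_X, derivative_along, eval_along, zero_smul, add_zero, zero_mul,
    mul_zero, zero_add, one_mul] at h'
  have h2 := br_ev_deriv f u w
  refine mul_right_cancel₀ hw ?_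
  rw [← h2]
  have h3 : br (f.ev u) (f.deriv u w) =
    br u w * MvPolynomial.eval (Sum.elim u u) (bracketQuotient f) := by
      simpa [br, Tuple.deriv_apply_two] using h'
  rw [h3]; ring

/-- The Jacobian determinant of the symmetric power on a product of linear forms. -/
theorem jacobian_symTuple [CharZero k] {n d : ℕ} (f : Tuple k 1 d) (v : Fin n → Fin 2 → k) :
    (d : k) ^ n * MvPolynomial.eval (fun c : Fin (n + 1) => (vietaPoly v).coeff c)
        (symTuple n f).jacobian =
      d * (∏ i, MvPolynomial.eval (v i) f.jacobian) *
        ∏ i, ∏ j ∈ Finset.Ioi i, MvPolynomial.eval (Sum.elim (v i) (v j)) (bracketQuotient f) := by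
  have hl := isPolyFun_genericLine v
  have H := IsPolyFun.eq_of_mul_eq
    (g := fun t => (d : k) ^ n * MvPolynomial.eval
      (fun c : Fin (n + 1) => (vietaPoly (genericLine v t)).coeff c) (symTuple n f).jacobian)
    (h := fun t => d * (∏ i, MvPolynomial.eval (genericLine v t i) f.jacobian) *
        ∏ i, ∏ j ∈ Finset.Ioi i, MvPolynomial.eval
          (Sum.elim (genericLine v t i) (genericLine v t j)) (bracketQuotient f))
    (e := fun t => (∏ i, br (genericLine v t i) ![-1, 1]) * disc (genericLine v t)) (a := 1)
    ((IsPolyFun.const _).mul (IsPolyFun.mvEval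
      (x := fun t (c : Fin (n + 1)) => (vietaPoly (genericLine v t)).coeff c)
      (fun c => IsPolyFun.coeff_vietaPoly hl c) _))
    (((IsPolyFun.const _).mul (IsPolyFun.prod _ fun i _ => IsPolyFun.mvEval (hl i) _)).mul
      (IsPolyFun.prod _ fun i _ => IsPolyFun.prod _ fun j _ => IsPolyFun.mvEval
        (fun c => by rcases c with c | c <;> simpa using hl _ c) _))
    ((IsPolyFun.prod _ fun i _ => IsPolyFun.br (hl i) fun l =>
      IsPolyFun.const ((![-1, 1] : Fin 2 → k) l)).mul (IsPolyFun.disc hl)) ?_ (fun t => ?_) 0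
  · simpa only [genericLine_zero] using H
  · exact mul_ne_zero (Finset.prod_ne_zero_iff.2 fun i _ => br_genericLine_one_ne_zero v i)
      (Finset.prod_ne_zero_iff.2 fun i _ => Finset.prod_ne_zero_iff.2 fun j hj =>
        br_genericLine_one_ne_zero' v (Finset.mem_Ioi.1 hj).ne)
  · generalize genericLine v t = z
    -- With `(-1, 1)` as every replacement vector, the determinant on the left is, up to sign,
    -- exactly the factor `e` being cancelled.
    have h1 := det_tangentMatrix_mul_jacobian f z fun _ => ![-1, 1]
    rw [det_tangentMatrix, det_tangentMatrix] at h1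
    have h2 : (d : k) ^ n * ∏ i, br (f.ev (z i)) (f.deriv (z i) ![-1, 1]) =
        (∏ i, MvPolynomial.eval (z i) f.jacobian) * ∏ i, br (z i) ![-1, 1] := by
      rw [← Finset.prod_mul_distrib, ← Finset.prod_congr rfl fun i _ => br_ev_deriv f (z i) _,
        Finset.prod_mul_distrib]
      simp
    have h3 : disc (fun i => f.ev (z i)) = disc z * ∏ i, ∏ j ∈ Finset.Ioi i,
        MvPolynomial.eval (Sum.elim (z i) (z j)) (bracketQuotient f) := by
      simp only [disc, br_ev, Finset.prod_mul_distrib]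
    rw [h3] at h1
    have hs : ((-1 : k) ^ n) * (-1) ^ n = 1 := by
      rw [← mul_pow]; simp
    set A := MvPolynomial.eval (fun c : Fin (n + 1) => (vietaPoly z).coeff c)
      (symTuple n f).jacobian
    set B := ∏ i, ∏ j ∈ Finset.Ioi i,
        MvPolynomial.eval (Sum.elim (z i) (z j)) (bracketQuotient f)
    set E := ∏ i, br (f.ev (z i)) (f.deriv (z i) ![-1, 1])
    set b := ∏ i, br (z i) ![-1, 1]
    linear_combination ((d : k) ^ n * (-1) ^ n) * h1 + (d * disc z * B) * h2 +
      ((d : k) ^ n * (d * E * (disc z * B)) - (d : k) ^ n * A * b * disc z) * hs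

theorem Tuple.eval_jacobian_smul {n d : ℕ} (f : Tuple k n d) (a b : k) (x : Fin (n + 1) → k) :
    MvPolynomial.eval (b • x) (a • f).jacobian =
      (a * b ^ (d - 1)) ^ (n + 1) * MvPolynomial.eval x f.jacobian := by
  have h : ∀ i j, MvPolynomial.eval (b • x) (MvPolynomial.pderiv j ((a • f) i).1) =
      (a * b ^ (d - 1)) * MvPolynomial.eval x (MvPolynomial.pderiv j (f i).1) := fun i j => by
    have hom := ((MvPolynomial.mem_homogeneousSubmodule d (f i).1).1 (f i).2).pderiv (i := j)
    have := congrFun (Tuple.ev_smul_arg (n := n) (d := d - 1) (fun _ => ⟨_,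
      (MvPolynomial.mem_homogeneousSubmodule _ _).2 hom⟩) b x) 0
    simp only [Tuple.ev, Pi.smul_apply, smul_eq_mul] at this
    have e : ((a • f) i).1 = a • (f i).1 := rfl
    rw [e, (MvPolynomial.pderiv j).map_smul, MvPolynomial.smul_eval, this, mul_assoc]
  rw [Tuple.eval_jacobian, Tuple.eval_jacobian]
  have : (Matrix.of fun i j => MvPolynomial.eval (b • x) (MvPolynomial.pderiv j ((a • f) i).1)) =
      (a * b ^ (d - 1)) • Matrix.of fun i j =>
        MvPolynomial.eval x (MvPolynomial.pderiv j (f i).1) := by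
    ext i j
    exact h i j
  rw [this, Matrix.det_smul, Fintype.card_fin]

theorem EndP.isCritical_mk {n d : ℕ} (f : Tuple k n d) (hf : f.Nondegenerate)
    (x : Fin (n + 1) → k) (hx : x ≠ 0) :
    (EndP.mk f hf).IsCritical (Projectivization.mk k x hx) ↔
      MvPolynomial.eval x f.jacobian = 0 := by
  obtain ⟨a, ha⟩ := Projectivization.exists_smul_eq_mk_rep k f hf.ne_zero
  obtain ⟨b, hb⟩ := Projectivization.exists_smul_eq_mk_rep k x hx
  change MvPolynomial.eval (Projectivization.mk k x hx).rep
    (Tuple.jacobian (Projectivization.mk k f hf.ne_zero).rep) = 0 ↔ _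
  rw [← ha, ← hb, Units.smul_def, Units.smul_def, Tuple.eval_jacobian_smul]
  simp

theorem isCritical_symPower_vieta [IsAlgClosed k] [CharZero k] {n d : ℕ} (hd : d ≠ 0)
    (f : EndP k 1 d) (P : Fin n → PSpace k 1) :
    (symPower n f).IsCritical (vieta P) ↔ (∃ i, f.IsCritical (P i)) ∨
      ∃ i j, i < j ∧ MvPolynomial.eval (Sum.elim (P i).rep (P j).rep)
        (bracketQuotient f.lift) = 0 := by
  have hd' : (d : k) ≠ 0 := Nat.cast_ne_zero.2 hd
  have h := jacobian_symTuple f.lift fun i => (P i).rep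
  rw [symPower, vieta, EndP.isCritical_mk, ← mul_right_inj' (pow_ne_zero n hd'), mul_zero, h,
    mul_eq_zero, mul_eq_zero, or_iff_right hd', Finset.prod_eq_zero_iff, Finset.prod_eq_zero_iff]
  simp [Finset.prod_eq_zero_iff, EndP.IsCritical]

/-- A symmetric power is critical at every divisor containing a critical point. -/
theorem isCritical_symPower_of_mem [IsAlgClosed k] [CharZero k] {n d : ℕ} (hd : d ≠ 0)
    (f : EndP k 1 d) (P : Fin n → PSpace k 1) (i : Fin n) (hi : f.IsCritical (P i)) :
    (symPower n f).IsCritical (vieta P) :=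
  (isCritical_symPower_vieta hd f P).2 (Or.inl ⟨i, hi⟩)

/-- If `f` is injective on the support of a critical divisor of its symmetric power, then the
support contains a critical point of `f`. -/
theorem exists_isCritical_of_symPower [IsAlgClosed k] [CharZero k] {n d : ℕ} (hd : d ≠ 0)
    (f : EndP k 1 d) (P : Fin n → PSpace k 1) (hinj : Set.InjOn f.map (Set.range P))
    (h : (symPower n f).IsCritical (vieta P)) : ∃ i, f.IsCritical (P i) := by
  rcases (isCritical_symPower_vieta hd f P).1 h with h | ⟨i, j, -, h⟩
  · exact h
  · have hbr := br_ev f.lift (P i).rep (P j).rep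
    rw [h, mul_zero] at hbr
    -- A zero of the quotient means that the images coincide; by injectivity the zero lies on the
    -- diagonal, where the quotient is `J_f / d`.
    have hPP : P i = P j := hinj ⟨i, rfl⟩ ⟨j, rfl⟩ ((mk_eq_mk_iff_br _ _).2 hbr)
    refine ⟨i, ?_⟩
    rw [← hPP] at h
    rw [EndP.IsCritical, ← bracketQuotient_diag _ (P i).rep_nonzero, h, mul_zero]

end Criterion

/-! ### Periodic divisors and periodic points -/

section Dynamics

variable {k : Type*} [Field k]

theorem vieta_surjective [IsAlgClosed k] {n : ℕ} (Q : PSpace k n) :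
    ∃ P : Fin n → PSpace k 1, vieta P = Q := by
  set p : k[X] := ∑ i : Fin (n + 1), monomial (i : ℕ) (Q.rep i) with hp
  have hcoeff : ∀ i : Fin (n + 1), p.coeff i = Q.rep i := fun i => by
    rw [hp, finsetSum_coeff, Finset.sum_eq_single i]
    · simp
    · intro j _ hj
      rw [coeff_monomial, if_neg (fun h => hj (Fin.ext h))]
    · simp
  have hp0 : p ≠ 0 := fun h => Q.rep_nonzero (by funext i; rw [← hcoeff, h]; simp)
  have hdeg : p.natDegree ≤ n := natDegree_sum_le_of_forall_le _ _ fun i _ =>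
    (natDegree_monomial_le _).trans (Nat.le_of_lt_succ i.2)
  obtain ⟨u, v, hu, hv, hpv⟩ := exists_vietaPoly n p hp0 hdeg
  refine ⟨fun i => Projectivization.mk k (v i) (hv i), ?_⟩
  rw [vieta_mk, ← Q.mk_rep, Projectivization.mk_eq_mk_iff']
  refine ⟨u⁻¹, ?_⟩
  funext i
  rw [Pi.smul_apply, ← hcoeff, hpv, coeff_C_mul, smul_eq_mul, inv_mul_cancel_left₀ hu]

/-- The support is the zero set of the form, so it can be recovered from `vieta P`. Multiplicities
are never needed. -/
theorem mem_range_iff_eval {n : ℕ} (P : Fin n → PSpace k 1) (Q : PSpace k 1) :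
    Q ∈ Set.range P ↔
      MvPolynomial.eval Q.rep ((vietaPoly fun i => (P i).rep).homogenize n) = 0 := by
  rw [eval_homogenize_vietaPoly, Finset.prod_eq_zero_iff]
  simp only [Finset.mem_univ, true_and, Set.mem_range]
  refine exists_congr fun i => ?_
  rw [← mk_eq_mk_iff_br Q.rep_nonzero (P i).rep_nonzero, Projectivization.mk_rep,
    Projectivization.mk_rep, eq_comm]

theorem range_subset_of_vieta_eq {n : ℕ} {P P' : Fin n → PSpace k 1} (h : vieta P = vieta P') :
    Set.range P' ⊆ Set.range P := by
  intro Q hQ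
  obtain ⟨a, ha⟩ := (Projectivization.mk_eq_mk_iff' k _ _ _ _).1 h
  rw [mem_range_iff_eval, eval_homogenize] at hQ ⊢
  have h' : ∀ c : Fin (n + 1), (vietaPoly fun i => (P i).rep).coeff c =
      a * (vietaPoly fun i => (P' i).rep).coeff c := fun c => (congrFun ha c).symm
  simp only [h', mul_assoc, ← Finset.mul_sum]
  rw [hQ, mul_zero]

theorem vieta_comp_perm {n : ℕ} (P : Fin n → PSpace k 1) (σ : Equiv.Perm (Fin n)) :
    vieta (P ∘ σ) = vieta P := by
  have h : (vietaPoly fun i => ((P ∘ σ) i).rep) = vietaPoly fun i => (P i).rep :=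
    Equiv.prod_comp σ fun i => (C ((P i).rep 1) * X - C ((P i).rep 0) : k[X])
  simp only [vieta, h]

theorem symPower_map_iterate_vieta [IsAlgClosed k] {n d : ℕ} (f : EndP k 1 d) (s : ℕ)
    (P : Fin n → PSpace k 1) :
    (symPower n f).map^[s] (vieta P) = vieta (f.map^[s] ∘ P) := by
  induction s generalizing P with
  | zero => rfl
  | succ s ih =>
    rw [Function.iterate_succ_apply, symPower_map_vieta, ih, Function.iterate_succ]
    rfl

theorem EndP.mk_lift {n d : ℕ} (f : EndP k n d) : EndP.mk f.lift f.lift_nondegenerate = f :=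
  Subtype.ext (Projectivization.mk_rep _)

/-- An endomorphism of the projective line has a fixed point. -/
theorem exists_map_eq_self [IsAlgClosed k] {d : ℕ} (f : EndP k 1 d) : ∃ Q, f.map Q = Q := by
  suffices h : ∃ u : Fin 2 → k, u ≠ 0 ∧ br (f.lift.ev u) u = 0 by
    obtain ⟨u, hu, h⟩ := h
    refine ⟨Projectivization.mk k u hu, ?_⟩
    conv_lhs => rw [← f.mk_lift]
    rw [EndP.map_mk]
    exact (mk_eq_mk_iff_br _ _).2 h
  set p : k[X] := X * dehom (f.lift 1) - dehom (f.lift 0) with hp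
  -- Roots of `p` are the finite fixed points. If `p` is a nonzero constant, its coefficient at `d +
  -- 1`, which is `f₁(1, 0)`, vanishes, so infinity is fixed. The zero polynomial falls in the other
  -- case, as its degree is `⊥`.
  by_cases hdeg : p.degree = 0
  · refine ⟨![1, 0], fun h => one_ne_zero (congrFun h 0), ?_⟩
    have h1 : p.coeff (d + 1) = (dehom (f.lift 1)).coeff d := by
      rw [hp, coeff_sub, coeff_X_mul,
        coeff_eq_zero_of_natDegree_lt (Nat.lt_succ_of_le (dehom_natDegree_le (f.lift 0))), sub_zero]
    have h2 : f.lift.ev ![1, 0] 1 = 0 := by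
      rw [Tuple.ev, eval_eq_dehom, Finset.sum_eq_single d, ← h1,
        coeff_eq_zero_of_natDegree_lt (by
          rw [natDegree_eq_zero_iff_degree_le_zero.2 hdeg.le]; exact Nat.succ_pos d)]
      · simp
      · intro j hj hjd
        have : d - j ≠ 0 := by
          have := Finset.mem_range.1 hj
          omega
        simp [this]
      · simp
    simp [br, h2]
  · obtain ⟨z, hz⟩ := IsAlgClosed.exists_root p hdeg
    refine ⟨![z, 1], fun h => one_ne_zero (congrFun h 1), ?_⟩
    have h : ∀ i, f.lift.ev ![z, 1] i = (dehom (f.lift i)).eval z := fun i => by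
      rw [Tuple.ev, eval_eq_dehom,
        eval_eq_sum_range' (Nat.lt_succ_of_le (dehom_natDegree_le (f.lift i)))]
      simp
    rw [IsRoot.def, hp, eval_sub, eval_mul, eval_X] at hz
    simp only [br, h, Matrix.cons_val_zero, Matrix.cons_val_one]
    linear_combination -hz

/-- A map permuting the image of a family of `n` points has on it periods at most `n`. -/
theorem exists_iterate_eq_of_image_eq {α : Type*} {n : ℕ} (g : α → α) (P : Fin n → α)
    (hmaps : Set.MapsTo g (Set.range P) (Set.range P)) (hinj : Set.InjOn g (Set.range P))
    (i : Fin n) : ∃ m, 1 ≤ m ∧ m ≤ n ∧ g^[m] (P i) = P i := by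
  have hmem : ∀ j, g^[j] (P i) ∈ Set.range P := fun j => hmaps.iterate j ⟨i, rfl⟩
  choose c hc using hmem
  -- The `n + 1` iterates of exponents `0, …, n` have only `n` available indices; injectivity then
  -- strips the common first `a` steps.
  obtain ⟨a, b, hab, h⟩ := Fintype.exists_ne_map_eq_of_card_lt (fun j : Fin (n + 1) => c j)
    (by simp)
  wlog hlt : a < b generalizing a b
  · exact this b a hab.symm h.symm (lt_of_le_of_ne (not_lt.1 hlt) hab.symm)
  have hlt' : (a : ℕ) < b := hlt
  refine ⟨b - a, by omega, by omega, ?_⟩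
  refine hinj.iterate hmaps a (hmaps.iterate _ ⟨i, rfl⟩) ⟨i, rfl⟩ ?_
  rw [← Function.iterate_add_apply, Nat.add_sub_cancel' hlt'.le, ← hc, ← hc]
  exact congrArg P h.symm

theorem exists_mem_Y_of_symPower_mem_Y [IsAlgClosed k] [CharZero k] {n d s : ℕ} (hd : d ≠ 0)
    (hs : s ≠ 0) {f : EndP k 1 d} (hf : symPower n f ∈ Y k n d s) :
    ∃ m, 1 ≤ m ∧ m ≤ n ∧ f ∈ Y k 1 d (m * s) := by
  obtain ⟨D, hcrit, hper⟩ := hf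
  obtain ⟨P, rfl⟩ := vieta_surjective D
  have hv : vieta (f.map^[s] ∘ P) = vieta P := (symPower_map_iterate_vieta f s P).symm.trans hper
  have himage : f.map^[s] '' Set.range P = Set.range P := by
    rw [← Set.range_comp]
    exact (range_subset_of_vieta_eq hv.symm).antisymm (range_subset_of_vieta_eq hv)
  have hmaps : Set.MapsTo f.map^[s] (Set.range P) (Set.range P) :=
    Set.mapsTo_iff_image_subset.2 himage.subset
  -- A map of a finite set onto itself is injective.
  have hinj : Set.InjOn f.map^[s] (Set.range P) :=
    Set.injOn_of_ncard_image_eq (by rw [himage]) (Set.finite_range P)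
  -- As `s ≥ 1`, `f` is the first step of `f^s` and inherits injectivity.
  have hinj' : Set.InjOn f.map (Set.range P) := fun x hx y hy h => by
    refine hinj hx hy ?_
    obtain ⟨r, rfl⟩ := Nat.exists_eq_succ_of_ne_zero hs
    rw [Function.iterate_succ_apply, Function.iterate_succ_apply, h]
  obtain ⟨i, hi⟩ := exists_isCritical_of_symPower hd f P hinj' hcrit
  obtain ⟨m, hm1, hmn, hm⟩ := exists_iterate_eq_of_image_eq _ P hmaps hinj i
  refine ⟨m, hm1, hmn, P i, hi, ?_⟩
  rw [Function.IsPeriodicPt, Function.IsFixedPt, mul_comm, Function.iterate_mul]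
  exact hm

theorem symPower_mem_Y [IsAlgClosed k] [CharZero k] {n d s m : ℕ} (hd : d ≠ 0) (hm : 1 ≤ m)
    (hmn : m ≤ n) {f : EndP k 1 d} (hf : f ∈ Y k 1 d (m * s)) : symPower n f ∈ Y k n d s := by
  obtain ⟨q, hcrit, hper⟩ := hf
  obtain ⟨Q, hQ⟩ := exists_map_eq_self f
  have hq : (f.map^[s])^[m] q = q := by
    rw [← Function.iterate_mul, mul_comm]
    exact hper
  have hn : n ≠ 0 := by omega
  have : NeZero n := ⟨hn⟩
  -- The divisor `q + f^s(q) + ⋯ + f^{(m-1)s}(q) + (n - m) Q`. The exact period of `q` under `f^s`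
  -- may be a proper divisor of `m`; repeated points do no harm.
  set P : Fin n → PSpace k 1 := fun i => if (i : ℕ) < m then (f.map^[s])^[(i : ℕ)] q else Q with hP
  have h0 : P 0 = q := by simp [hP, Nat.pos_of_ne_zero (Nat.one_le_iff_ne_zero.1 hm)]
  -- `f^s` acts on the family as the cyclic shift of the indices `0, …, m - 1`, fixing the others,
  -- and `vieta` ignores the order.
  have hstep : f.map^[s] ∘ P = P ∘ Fin.cycleRange ⟨m - 1, by omega⟩ := by
    funext i
    rw [Function.comp_apply, Function.comp_apply]
    rcases lt_trichotomy (i : ℕ) (m - 1) with h | h | h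
    · have e := Fin.coe_cycleRange_of_lt (i := i) (j := ⟨m - 1, by omega⟩) h
      simp only [hP, e]
      rw [if_pos (by omega), if_pos (by omega), Function.iterate_succ_apply']
    · rw [Fin.cycleRange_of_eq (Fin.ext h), h0]
      simp only [hP]
      rw [if_pos (by omega), ← Function.iterate_succ_apply' f.map^[s], h, Nat.succ_eq_add_one,
        Nat.sub_add_cancel hm, hq]
    · rw [Fin.cycleRange_of_gt h]
      simp only [hP]
      rw [if_neg (by omega)]
      exact Function.IsFixedPt.iterate hQ s
  refine ⟨vieta P, isCritical_symPower_of_mem hd f P 0 (by rwa [h0]), ?_⟩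
  rw [Function.IsPeriodicPt, Function.IsFixedPt, symPower_map_iterate_vieta, hstep,
    vieta_comp_perm]

end Dynamics

end ProjDyn

theorem mainTheorem6 {k : Type*} [Field k] [IsAlgClosed k] [CharZero k] (n d : ℕ) (hn : 1 ≤ n)
    (hd : 2 ≤ d) (s : ℕ) (hs : 1 ≤ s) :
    (fun f : ProjDyn.EndP k 1 d => ProjDyn.symPower n f) ⁻¹' ProjDyn.Y k n d s =
      ⋃ t ∈ {t : ℕ | ∃ m : ℕ, 1 ≤ m ∧ m ≤ n ∧ t ∣ m * s}, ProjDyn.Y k 1 d t := by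
  ext f
  simp only [Set.mem_preimage, Set.mem_iUnion, Set.mem_ofPred_eq, exists_prop]
  constructor
  · intro hf
    obtain ⟨m, hm1, hmn, h⟩ :=
      ProjDyn.exists_mem_Y_of_symPower_mem_Y (by omega) (by omega) hf
    exact ⟨m * s, ⟨m, hm1, hmn, dvd_rfl⟩, h⟩
  · rintro ⟨t, ⟨m, hm1, hmn, ht⟩, P, hcrit, hper⟩
    exact ProjDyn.symPower_mem_Y (by omega) hm1 hmn ⟨P, hcrit, hper.trans_dvd ht⟩
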